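/- **Setting.** Let $\lambda_{\max}\in(0,\infty]$ and let $\psi:[0,\lambda_{\max})\to[0,\infty)$ be CGF-like (twice continuously differentiable, strictly convex, $\psi(0)=\psi'(0)=0$, $\psi''(0)>0$), with $\sup_\lambda\psi'(\lambda)=\infty$, and super-Gaussian ($\psi(\lambda)/\lambda^2$ is non-decreasing on $(0,\lambda_{\max})$). Let $\psi^*(u)=\sup_{\lambda\in[0,\lambda_{\max})}(u\lambda-\psi(\lambda))$ and let $(\psi^*)^{-1}$ be the inverse of $\psi^*:[0,\infty)\to[0,\infty)$. On a probability space with a filtration $(\mathcal F_t)_{t\in\mathbb N}$, where $\mathbb N=\{0,1,2,\dots\}$, and for $d\ge1$, let $(S_t)_{t\in\mathbb N}$ be an adapted process in $\mathbb R^d$ and $(V_t)_{t\in\mathbb N}$ an adapted process of positive semi-definite $d\times d$ matrices. Assume that $(S_t,V_t)$ is sub-$\psi$: for every unit vector $\nu$ and every $\lambda\in[0,\lambda_{\max})$ there is a non-negative supermartingale $(L_t)_{t\in\mathbb N}$ with $\mathbb E L_0\le1$ and, almost surely, $\exp\{\lambda\langle\nu,S_t\rangle-\psi(\lambda)\langle\nu,V_t\nu\rangle\}\le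 L_t$ for all $t$. Let $\alpha>1$, $\beta>1$, $\rho>0$, $\epsilon\in(0,1)$, $\delta\in(0,1)$, and let $h:[0,\infty)\to\mathbb R$ be non-decreasing with $h(k)>0$ for $k\in\mathbb N$ and $\sum_{k\ge0}h(k)^{-1}\le1$. For a positive semi-definite matrix $V=\sum_n\gamma_nv_nv_n^\top$ (with orthonormal $v_n$) put $V\vee\rho I=\sum_n\max(\gamma_n,\rho)v_nv_n^\top$. Let $\gamma_{\max},\gamma_{\min}$ denote the largest and smallest eigenvalue, and $\kappa=\gamma_{\max}/\gamma_{\min}$. Let $C_d=2d\,\mathrm{Vol}(B^\infty_{d-1})/\mathrm{Vol}(B_{d-1})$, where $B^\infty_{d-1}$ and $B_{d-1}$ are the unit balls of $\ell_\infty$ and $\ell_2$ in $\mathbb R^{d-1}$ (so $C_1=2$), and $$L^{\rm cov}_\rho(V)=\log h\Big(\log_\alpha\frac{\gamma_{\max}(V\vee\rho I)}{\rho}\Big)+\log\frac{C_d}{\delta(1-\beta^{-1})}+d\log\frac{3\beta\sqrt{\kappa(V\vee\rho I)}}{\epsilon}.$$ **Bound.** Then $$\mathbb P\Big(\exists t\ge0:\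 \big\|(V_t\vee\rho I)^{-1/2}S_t\big\|\ge\frac{\sqrt{\gamma_{\min}(V_t\vee\rho I)}}{1-\epsilon}\,(\psi^*)^{-1}\Big(\frac{\alpha}{\gamma_{\min}(V_t\vee\rho I)}L^{\rm cov}_\rho(V_t)\Big)\Big)\le\delta.$$ **Rate.** Suppose moreover that $\log h(k)=O(\log k)$ as $k\to\infty$ over $\mathbb N$. Write $W_t=V_t\vee\rho I$ (which is $V_t$ whenever $V_t\succeq\rho I$). For constants $K>0$ and $\Gamma>e$ consider the statement that, for all processes as above, $$\mathbb P\Big(\exists t\ge0:\ \gamma_{\max}(W_t)\ge\Gamma,\ \big\|W_t^{-1/2}S_t\big\|\ge K\sqrt{\gamma_{\min}(W_t)}\,(\psi^*)^{-1}\Big(\frac{\log\log\gamma_{\max}(W_t)+d\log\kappa(W_t)}{\gamma_{\min}(W_t)}\Big)\Big)\le\delta.\qquad(\ast)$$ (a) There is $K$, depending only on $\alpha,\beta,\rho,\epsilon,h$, such that for all $d\ge1$ and $\delta\in(0,1)$ there is a $\Gamma>e$, depending only on $\alpha,\beta,\rho,\epsilon,h,d,\delta$, for which $(\ast)$ holds.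 (b) For all $d\ge1$, $\delta\in(0,1)$ and every $\Gamma>e$ there is $K$, depending only on $\alpha,\beta,\rho,\epsilon,h,d,\delta,\Gamma$, for which $(\ast)$ holds. -/

import Mathlib

open MeasureTheory ProbabilityTheory Set Filter
open scoped ENNReal Topology

namespace SelfNorm

noncomputable section

/-! ### CGF-like functions -/

/-- The interval `[0, Λ)` for `Λ ∈ (0, ∞]`. -/
def dom (Λ : EReal) : Set ℝ := {l : ℝ | 0 ≤ l ∧ (l : EReal) < Λ}

/-- `ψ : [0, Λ) → [0, ∞)` is CGF-like: twice continuously differentiable (one-sidedly at `0`),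
strictly convex, `ψ(0) = ψ'(0) = 0` and `ψ''(0) > 0`. Values of `ψ` off `[0, Λ)` play no role. -/
structure IsCGFLike (Λ : EReal) (ψ : ℝ → ℝ) : Prop where
  pos : 0 < Λ
  nonneg : ∀ l ∈ dom Λ, 0 ≤ ψ l
  contDiffOn : ContDiffOn ℝ 2 ψ (dom Λ)
  strictConvexOn : StrictConvexOn ℝ (dom Λ) ψ
  zero : ψ 0 = 0
  deriv_zero : derivWithin ψ (dom Λ) 0 = 0
  deriv2_zero : 0 < derivWithin (derivWithin ψ (dom Λ)) (dom Λ) 0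

/-- `sup_{[0, Λ)} ψ' = ∞`. -/
def HasUnboundedDeriv (Λ : EReal) (ψ : ℝ → ℝ) : Prop :=
  ∀ M : ℝ, ∃ l ∈ dom Λ, M < derivWithin ψ (dom Λ) l

/-- `ψ` is super-Gaussian: `ψ(l) / l²` is non-decreasing on `(0, Λ)`. -/
def IsSuperGaussian (Λ : EReal) (ψ : ℝ → ℝ) : Prop :=
  MonotoneOn (fun l => ψ l / l ^ 2) (dom Λ \ {0})

/-- The convex conjugate `ψ*(u) = sup_{l ∈ [0, Λ)} (u l - ψ(l))`. -/
def conj (Λ : EReal) (ψ : ℝ → ℝ) (u : ℝ) : ℝ :=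
  sSup ((fun l => u * l - ψ l) '' dom Λ)

/-- The inverse `(ψ*)⁻¹` of `ψ* : [0, ∞) → [0, ∞)`. -/
def conjInv (Λ : EReal) (ψ : ℝ → ℝ) : ℝ → ℝ :=
  Function.invFunOn (conj Λ ψ) (Ici 0)

/-! ### Sub-ψ processes -/

/-- The real process `S` is sub-`ψ` with variance proxy `V`: for each `l ∈ [0, Λ)` the process
`exp (l S_t - ψ(l) V_t)` is almost surely dominated by a non-negative supermartingale whose
initial value has expectation at most one. -/
structure IsSubPsi {Ω : Type*} [MeasurableSpace Ω] (μ : Measure Ω)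
    (ℱ : Filtration ℕ (inferInstance : MeasurableSpace Ω)) (Λ : EReal) (ψ : ℝ → ℝ)
    (S V : ℕ → Ω → ℝ) : Prop where
  adapted_S : StronglyAdapted ℱ S
  adapted_V : StronglyAdapted ℱ V
  nonneg_V : ∀ t ω, 0 ≤ V t ω
  dominated : ∀ l ∈ dom Λ, ∃ L : ℕ → Ω → ℝ,
    Supermartingale L ℱ μ ∧ (∀ t, 0 ≤ᵐ[μ] L t) ∧ ∫ ω, L 0 ω ∂μ ≤ 1 ∧
      ∀ t, ∀ᵐ ω ∂μ, Real.exp (l * S t ω - ψ l * V t ω) ≤ L t ω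

/-- The action of a matrix on Euclidean space. -/
abbrev act {d : ℕ} (A : Matrix (Fin d) (Fin d) ℝ) (x : EuclideanSpace ℝ (Fin d)) :
    EuclideanSpace ℝ (Fin d) :=
  Matrix.toEuclideanCLM (𝕜 := ℝ) A x

/-- The `ℝᵈ`-valued process `S` is sub-`ψ` with variance proxy `V`, a process of positive
semi-definite matrices: every one-dimensional projection is. -/
structure IsVecSubPsi {Ω : Type*} [MeasurableSpace Ω] (μ : Measure Ω)
    (ℱ : Filtration ℕ (inferInstance : MeasurableSpace Ω)) (Λ : EReal) (ψ : ℝ → ℝ) {d : ℕ}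
    (S : ℕ → Ω → EuclideanSpace ℝ (Fin d)) (V : ℕ → Ω → Matrix (Fin d) (Fin d) ℝ) : Prop where
  adapted_S : StronglyAdapted ℱ S
  adapted_V : ∀ i j, StronglyAdapted ℱ (fun t ω => V t ω i j)
  posSemidef_V : ∀ t ω, (V t ω).PosSemidef
  proj : ∀ ν : EuclideanSpace ℝ (Fin d), ‖ν‖ = 1 →
    IsSubPsi μ ℱ Λ ψ (fun t ω => inner ℝ ν (S t ω)) (fun t ω => inner ℝ ν (act (V t ω) ν))

/-! ### Spectral quantities of a symmetric matrix -/

/-- The largest eigenvalue. -/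
def gmax {d : ℕ} (V : Matrix (Fin d) (Fin d) ℝ) : ℝ := sSup (spectrum ℝ V)

/-- The smallest eigenvalue. -/
def gmin {d : ℕ} (V : Matrix (Fin d) (Fin d) ℝ) : ℝ := sInf (spectrum ℝ V)

/-- The condition number (used only for positive definite matrices). -/
def cond {d : ℕ} (V : Matrix (Fin d) (Fin d) ℝ) : ℝ := gmax V / gmin V

/-- `V ∨ ρI`: the same eigenvectors, each eigenvalue `γ` replaced by `max γ ρ`. -/
def clip {d : ℕ} (V : Matrix (Fin d) (Fin d) ℝ) (ρ : ℝ) : Matrix (Fin d) (Fin d) ℝ :=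
  cfc (fun x : ℝ => max x ρ) V

/-- `W^{-1/2}`: the same eigenvectors, each eigenvalue `γ` replaced by `γ^{-1/2}` (used only for
positive definite matrices). -/
def invSqrt {d : ℕ} (W : Matrix (Fin d) (Fin d) ℝ) : Matrix (Fin d) (Fin d) ℝ :=
  cfc (fun x : ℝ => (Real.sqrt x)⁻¹) W

/-! ### The boundary -/

/-- `C_d = 2 d Vol(B^∞_{d-1}) / Vol(B_{d-1})`, with `B^∞` and `B` the closed unit balls of the
supremum and the Euclidean norm on `ℝ^{d-1}` (both volumes are one when `d = 1`). -/
def coverConst (d : ℕ) : ℝ :=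
  2 * d * ((volume (Metric.closedBall (0 : Fin (d - 1) → ℝ) 1)).toReal /
    (volume (Metric.closedBall (0 : EuclideanSpace ℝ (Fin (d - 1))) 1)).toReal)

/-- The function `L^cov_ρ`. -/
def Lcov {d : ℕ} (α β ρ ε δ : ℝ) (h : ℝ → ℝ) (V : Matrix (Fin d) (Fin d) ℝ) : ℝ :=
  Real.log (h (Real.logb α (gmax (clip V ρ) / ρ)))
    + Real.log (coverConst d / (δ * (1 - β⁻¹)))
    + d * Real.log (3 * β * Real.sqrt (cond (clip V ρ)) / ε)

/-- `√γ_min(W) (ψ*)⁻¹(x / γ_min(W))`. -/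
def scale {d : ℕ} (Λ : EReal) (ψ : ℝ → ℝ) (W : Matrix (Fin d) (Fin d) ℝ) (x : ℝ) : ℝ :=
  Real.sqrt (gmin W) * conjInv Λ ψ (x / gmin W)

/-- `log log γ_max(W) + d log κ(W)`. -/
def rate {d : ℕ} (W : Matrix (Fin d) (Fin d) ℝ) : ℝ :=
  Real.log (Real.log (gmax W)) + d * Real.log (cond W)

end

end SelfNorm

/-! Crossing the boundary is covered by countably many crossings of straight lines by
one-dimensional projections, and each of these is controlled by Ville's inequality
(`supermartingale_maximal_ineq`, `IsSubPsi.measure_crossing_le`).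

Write `W` for the clipped matrix and choose `j` with `β^j ≤ √κ(W) < β^(j+1)`. A sphere net of mesh
`ε / β^(j+1)` contains a `ν` nearly aligned, in the geometry of `W^{1/2}`, with the ideal direction
`W⁻¹s` (`exists_direction`). So `⟨ν, s⟩` is at least `√m √γ_min (ψ*)⁻¹(αL / γ_min)` with `m = ⟨ν,
Wν⟩`. Super-Gaussianity lets `m` replace `γ_min` inside (`IsCGFLike.sqrt_mul_conjInv_anti`).
Choosing `k` with `ρα^k ≤ m < ρα^(k+1)` gives `⟨ν, s⟩ ≥ m (ψ*)⁻¹(c)` with `c = level / (ρα^k)`, and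
the slope `l` tangent at height `c` turns this into a line crossing at height `level`
(`exists_crossing`).

The level is tuned so that the event for `(j, k, ν)` costs `δ (1 - β⁻¹) β⁻ʲ / (h(k) N_j)`, where
`N_j` is the size of the net; these costs sum to at most `δ`. Here `L` must dominate `level`: the
net has order `η^(-(d-1))` points, and the weight `β^j` supplies the missing `d`-th factor
(`log_card_le`).

For the rate, `L` is at most a multiple of `log log γ_max + d log κ` once the constant terms are
absorbed into `log log Γ`. Enlarging either `Γ` or the multiple achieves this, which gives the two
versions. -/

namespace SelfNorm

/-! ### The inverse conjugate as the slope of a tangent line -/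

section Conjugate

variable {Λ : EReal} {ψ : ℝ → ℝ}

lemma convex_dom (Λ : EReal) : Convex ℝ (dom Λ) := by
  refine Set.OrdConnected.convex ⟨fun x hx y hy z hz => ⟨hx.1.trans hz.1, lt_of_le_of_lt ?_ hy.2⟩⟩
  exact_mod_cast hz.2

lemma zero_mem_dom (h : 0 < Λ) : (0 : ℝ) ∈ dom Λ := ⟨le_rfl, by simpa using h⟩

lemma exists_pos_mem_dom (h : 0 < Λ) : ∃ l ∈ dom Λ, 0 < l := by
  obtain ⟨q, h0, hq⟩ := EReal.lt_iff_exists_real_btwn.1 h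
  have : 0 < q := by exact_mod_cast h0
  exact ⟨q, ⟨this.le, hq⟩, this⟩

lemma uniqueDiffOn_dom (h : 0 < Λ) : UniqueDiffOn ℝ (dom Λ) := by
  refine uniqueDiffOn_convex (convex_dom Λ) ?_
  obtain ⟨l, hl, hl0⟩ := exists_pos_mem_dom h
  refine ⟨l / 2, mem_interior_iff_mem_nhds.2 ?_⟩
  refine Filter.mem_of_superset (Icc_mem_nhds (half_pos hl0) (half_lt_self hl0)) ?_
  intro x hx
  refine ⟨hx.1, lt_of_le_of_lt ?_ hl.2⟩
  exact_mod_cast hx.2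

lemma IsCGFLike.tangent_le (hψ : IsCGFLike Λ ψ) {a b : ℝ} (ha : a ∈ dom Λ) (hb : b ∈ dom Λ) :
    ψ a + derivWithin ψ (dom Λ) a * (b - a) ≤ ψ b := by
  have hd : HasDerivWithinAt ψ (derivWithin ψ (dom Λ) a) (dom Λ) a :=
    ((hψ.contDiffOn.differentiableOn (by norm_num)) a ha).hasDerivWithinAt
  have hc := hψ.strictConvexOn.convexOn
  rcases lt_trichotomy a b with hab | rfl | hab
  · have := hc.le_slope_of_hasDerivWithinAt ha hb hab hd
    rw [slope_def_field, le_div_iff₀ (sub_pos.2 hab)] at this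
    linarith
  · simp
  · have := hc.slope_le_of_hasDerivWithinAt hb ha hab hd
    rw [slope_def_field, div_le_iff₀ (sub_pos.2 hab)] at this
    linarith

/-- The tangent to `ψ` through `(0, -c)`. -/
lemma IsCGFLike.exists_tangent (hψ : IsCGFLike Λ ψ) (hu : HasUnboundedDeriv Λ ψ) {c : ℝ}
    (hc : 0 < c) :
    ∃ u l, 0 < u ∧ l ∈ dom Λ ∧ 0 < l ∧ u * l = c + ψ l ∧ ∀ x ∈ dom Λ, u * x ≤ c + ψ x := by
  obtain ⟨a, ha, ha0⟩ := exists_pos_mem_dom hψ.pos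
  have h0 := zero_mem_dom hψ.pos
  obtain ⟨b, hb, hbM⟩ := hu ((c + ψ a) / a)
  rw [div_lt_iff₀ ha0] at hbM
  have hcont : ContinuousOn (fun l => derivWithin ψ (dom Λ) l * l - ψ l) (dom Λ) :=
    ((hψ.contDiffOn.continuousOn_derivWithin (uniqueDiffOn_dom hψ.pos) (by norm_num)).mul
      continuousOn_id).sub hψ.contDiffOn.continuousOn
  have hmem : c ∈ Icc (derivWithin ψ (dom Λ) 0 * 0 - ψ 0) (derivWithin ψ (dom Λ) b * b - ψ b) := by
    refine ⟨by simp [hψ.zero, hc.le], ?_⟩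
    -- The tangent at `b`, read at `a`, gives `ψ'(b) b - ψ(b) ≥ ψ'(b) a - ψ(a) > c`.
    have := hψ.tangent_le hb ha
    nlinarith
  obtain ⟨l, hl, hlc⟩ := (convex_dom Λ).isPreconnected.intermediate_value h0 hb hcont hmem
  simp only at hlc
  have hl0 : 0 < l := by
    rcases hl.1.eq_or_lt with h | h
    · rw [← h, hψ.zero] at hlc; simp at hlc; linarith
    · exact h
  refine ⟨derivWithin ψ (dom Λ) l, l, ?_, hl, hl0, by linarith, fun x hx => ?_⟩
  · have := hψ.nonneg l hl
    by_contra! hneg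
    nlinarith
  · have := hψ.tangent_le hl hx
    nlinarith

/-- This says `(ψ*)⁻¹(c) = min_{l > 0} (c + ψ(l)) / l`, with the minimum attained. Every later
property of the inverse follows by testing this formula at a suitable `l`. -/
lemma IsCGFLike.conjInv_spec (hψ : IsCGFLike Λ ψ) (hu : HasUnboundedDeriv Λ ψ) {c : ℝ}
    (hc : 0 < c) :
    0 < conjInv Λ ψ c ∧ (∃ l ∈ dom Λ, 0 < l ∧ conjInv Λ ψ c * l = c + ψ l) ∧
      ∀ x ∈ dom Λ, conjInv Λ ψ c * x ≤ c + ψ x := by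
  obtain ⟨u, l, hu0, hl, hl0, hul, hux⟩ := hψ.exists_tangent hu hc
  have h0 := zero_mem_dom hψ.pos
  have hconj : conj Λ ψ u = c := by
    refine IsGreatest.csSup_eq ⟨⟨l, hl, by simp only; linarith⟩, ?_⟩
    rintro _ ⟨x, hx, rfl⟩
    have := hux x hx
    simp only; linarith
  have hex : ∃ v ∈ Ici (0 : ℝ), conj Λ ψ v = c := ⟨u, hu0.le, hconj⟩
  have hv0 : 0 ≤ conjInv Λ ψ c := Function.invFunOn_mem hex
  have hv : conj Λ ψ (conjInv Λ ψ c) = c := Function.invFunOn_eq hex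
  suffices h : conjInv Λ ψ c = u by rw [h]; exact ⟨hu0, ⟨l, hl, hl0, hul⟩, hux⟩
  set v := conjInv Λ ψ c
  -- An unbounded `sSup` would be `0`, which differs from `c`.
  have hbdd : BddAbove ((fun l => v * l - ψ l) '' dom Λ) := by
    by_contra hb
    rw [conj, Real.sSup_of_not_bddAbove hb] at hv
    exact hc.ne hv
  have hle : ∀ x ∈ dom Λ, v * x - ψ x ≤ c := fun x hx => by
    rw [← hv]; exact le_csSup hbdd ⟨x, hx, rfl⟩
  have hvu : v ≤ u := by
    have := hle l hl
    exact le_of_mul_le_mul_right (by linarith) hl0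
  refine hvu.antisymm (not_lt.1 fun hlt => ?_)
  -- If `v < u`, the conjugate at `v` is bounded away from `c`: below the cutoff `m` the values are
  -- at most `u m = c / 2`, and above it they lose at least `(u - v) m`.
  set m := c / (2 * u)
  have hm : u * m = c / 2 := by simp only [m]; field_simp
  have hm0 : 0 < m := by positivity
  have key : conj Λ ψ v ≤ max (c / 2) (c - (u - v) * m) := by
    refine csSup_le ⟨_, 0, h0, rfl⟩ ?_
    rintro _ ⟨x, hx, rfl⟩
    simp only
    rcases le_total x m with hxm | hxm
    · refine le_max_of_le_left ?_
      have := hψ.nonneg x hx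
      have := mul_le_mul hvu hxm hx.1 hu0.le
      linarith
    · refine le_max_of_le_right ?_
      have := hux x hx
      nlinarith
  rw [hv] at key
  rcases le_max_iff.1 key with h | h
  · linarith
  · nlinarith

lemma IsCGFLike.conjInv_mono (hψ : IsCGFLike Λ ψ) (hu : HasUnboundedDeriv Λ ψ) {c c' : ℝ}
    (hc : 0 < c) (hcc : c ≤ c') : conjInv Λ ψ c ≤ conjInv Λ ψ c' := by
  obtain ⟨-, -, h1⟩ := hψ.conjInv_spec hu hc
  obtain ⟨-, ⟨l, hl, hl0, h2⟩, -⟩ := hψ.conjInv_spec hu (hc.trans_le hcc)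
  have := h1 l hl
  exact le_of_mul_le_mul_right (by linarith) hl0

lemma IsCGFLike.conjInv_mul_le (hψ : IsCGFLike Λ ψ) (hu : HasUnboundedDeriv Λ ψ) {c A : ℝ}
    (hc : 0 < c) (hA : 1 ≤ A) : conjInv Λ ψ (A * c) ≤ A * conjInv Λ ψ c := by
  obtain ⟨-, -, h1⟩ := hψ.conjInv_spec hu (c := A * c) (by positivity)
  obtain ⟨-, ⟨l, hl, hl0, h2⟩, -⟩ := hψ.conjInv_spec hu hc
  have := h1 l hl
  have := hψ.nonneg l hl
  refine le_of_mul_le_mul_right ?_ hl0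
  nlinarith

/-- For super-Gaussian `ψ` the map `m ↦ √m (ψ*)⁻¹(c / m)` is non-increasing. -/
lemma IsCGFLike.sqrt_mul_conjInv_anti (hψ : IsCGFLike Λ ψ) (hu : HasUnboundedDeriv Λ ψ)
    (hs : IsSuperGaussian Λ ψ) {c m m' : ℝ} (hc : 0 < c) (hm : 0 < m) (hmm : m ≤ m') :
    √m' * conjInv Λ ψ (c / m') ≤ √m * conjInv Λ ψ (c / m) := by
  have hm' := hm.trans_le hmm
  obtain ⟨-, -, h1⟩ := hψ.conjInv_spec hu (c := c / m') (by positivity)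
  obtain ⟨-, ⟨l, hl, hl0, h2⟩, -⟩ := hψ.conjInv_spec hu (c := c / m) (by positivity)
  set r := √m
  set r' := √m'
  have hr : 0 < r := Real.sqrt_pos.2 hm
  have hr' : 0 < r' := Real.sqrt_pos.2 hm'
  have hrr : r ≤ r' := Real.sqrt_le_sqrt hmm
  have er : r ^ 2 = m := Real.sq_sqrt hm.le
  have er' : r' ^ 2 = m' := Real.sq_sqrt hm'.le
  -- With `x √m' = l √m`, super-Gaussianity gives `m' ψ(x) ≤ m ψ(l)`. Testing the minimum for `m'`
  -- at `x` is then no worse than the minimizer `l` for `m`.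
  set x := l * r / r'
  have hxl : x ≤ l := by
    rw [div_le_iff₀ hr']; exact mul_le_mul_of_nonneg_left hrr hl0.le
  have hx0 : 0 < x := by positivity
  have hx : x ∈ dom Λ := ⟨hx0.le, lt_of_le_of_lt (by exact_mod_cast hxl) hl.2⟩
  have hmono : ψ x / x ^ 2 ≤ ψ l / l ^ 2 := hs ⟨hx, hx0.ne'⟩ ⟨hl, hl0.ne'⟩ hxl
  have hψx : r' ^ 2 * ψ x ≤ r ^ 2 * ψ l := by
    rw [div_le_div_iff₀ (by positivity) (by positivity)] at hmono
    have e : x ^ 2 * r' ^ 2 = l ^ 2 * r ^ 2 := by simp only [x]; field_simp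
    have hl2 : 0 < l ^ 2 := by positivity
    refine le_of_mul_le_mul_left ?_ hl2
    have := mul_le_mul_of_nonneg_right hmono (sq_nonneg r')
    linear_combination this + ψ l * e
  have h3 := h1 x hx
  rw [← er'] at h3
  rw [← er] at h2
  set I' := conjInv Λ ψ (c / r' ^ 2)
  set I := conjInv Λ ψ (c / r ^ 2)
  have h3' : r' * I' * (l * r) ≤ c + r' ^ 2 * ψ x := by
    have e : r' * I' * (l * r) = r' ^ 2 * (I' * x) := by simp only [x]; field_simp
    rw [e]
    calc _ ≤ r' ^ 2 * (c / r' ^ 2 + ψ x) := by gcongr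
      _ = _ := by field_simp
  have h2' : r * I * (l * r) = c + r ^ 2 * ψ l := by
    have e : r * I * (l * r) = r ^ 2 * (I * l) := by ring
    rw [e, h2]; field_simp
  rw [← er, ← er']
  exact le_of_mul_le_mul_right (by linarith) (mul_pos hl0 hr)

end Conjugate

/-! ### Ville's inequality and line crossings -/

section Maximal

variable {Ω : Type*} [m0 : MeasurableSpace Ω] {μ : Measure Ω} [IsProbabilityMeasure μ]
  {ℱ : Filtration ℕ m0}

/-- Optional stopping at the first entry into `[c, ∞)`, capped at `n`, followed by Markov's
inequality for the stopped value. -/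
lemma supermartingale_maximal_ineq_upto {L : ℕ → Ω → ℝ} (hL : Supermartingale L ℱ μ)
    (hL0 : ∀ t, 0 ≤ᵐ[μ] L t) {c : ℝ} (hc : 0 < c) (n : ℕ) :
    c * μ.real {ω | ∃ t ≤ n, c ≤ L t ω} ≤ ∫ ω, L 0 ω ∂μ := by
  set τ : Ω → ℕ∞ := fun ω => (hittingBtwn L (Ici c) 0 n ω : ℕ)
  have hτ : IsStoppingTime ℱ τ :=
    hL.stronglyAdapted.adapted.isStoppingTime_hittingBtwn measurableSet_Ici
  have hτn : ∀ ω, τ ω ≤ n := fun ω => Nat.cast_le.2 (hittingBtwn_le (ι := ℕ) ω)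
  have hneg : Submartingale (-L) ℱ μ := hL.neg
  have hmono := hneg.expected_stoppedValue_mono (isStoppingTime_const ℱ 0) hτ
    (fun ω => zero_le) hτn
  have hint : Integrable (stoppedValue L τ) μ := by
    have := (hneg.integrable_stoppedValue hτ hτn).neg
    refine this.congr (Eventually.of_forall fun ω => ?_)
    simp [stoppedValue]
  have hmono' : ∫ ω, stoppedValue L τ ω ∂μ ≤ ∫ ω, L 0 ω ∂μ := by
    have e1 : stoppedValue (-L) τ = fun ω => -stoppedValue L τ ω := by
      ext ω; simp [stoppedValue]
    have e2 : stoppedValue (-L) (fun _ => (0 : ℕ∞)) = fun ω => -L 0 ω := by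
      ext ω; rfl
    have h := hmono
    change ∫ ω, stoppedValue (-L) (fun _ => (0 : ℕ∞)) ω ∂μ ≤ _ at h
    rw [e1, e2, integral_neg, integral_neg] at h
    linarith
  have hnn : 0 ≤ᵐ[μ] stoppedValue L τ := by
    filter_upwards [ae_all_iff.2 hL0] with ω hω
    exact hω _
  have hsub : {ω | ∃ t ≤ n, c ≤ L t ω} ⊆ {ω | c ≤ stoppedValue L τ ω} := by
    rintro ω ⟨t, ht, hct⟩
    exact stoppedValue_hittingBtwn_mem (s := Ici c) ⟨t, ⟨zero_le, ht⟩, hct⟩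
  calc _ ≤ c * μ.real {ω | c ≤ stoppedValue L τ ω} := by
        gcongr
        · exact measure_ne_top _ _
    _ ≤ ∫ ω, stoppedValue L τ ω ∂μ := mul_meas_ge_le_integral_of_nonneg hnn hint c
    _ ≤ _ := hmono'

/-- **Ville's inequality**. -/
lemma supermartingale_maximal_ineq {L : ℕ → Ω → ℝ} (hL : Supermartingale L ℱ μ)
    (hL0 : ∀ t, 0 ≤ᵐ[μ] L t) (hinit : ∫ ω, L 0 ω ∂μ ≤ 1) {c : ℝ} (hc : 0 < c) :
    μ {ω | ∃ t, c ≤ L t ω} ≤ ENNReal.ofReal c⁻¹ := by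
  have e : {ω | ∃ t, c ≤ L t ω} = ⋃ n : ℕ, {ω | ∃ t ≤ n, c ≤ L t ω} := by
    ext ω
    simp only [mem_ofPred_eq, mem_iUnion]
    exact ⟨fun ⟨t, ht⟩ => ⟨t, t, le_rfl, ht⟩, fun ⟨_, t, _, ht⟩ => ⟨t, ht⟩⟩
  have hmono : Monotone fun n : ℕ => {ω | ∃ t ≤ n, c ≤ L t ω} :=
    fun n n' hn ω ⟨t, ht, h⟩ => ⟨t, ht.trans hn, h⟩
  rw [e, hmono.measure_iUnion]
  refine iSup_le fun n => ?_
  rw [← ENNReal.ofReal_toReal (measure_ne_top μ _)]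
  refine ENNReal.ofReal_le_ofReal ?_
  have := (supermartingale_maximal_ineq_upto hL hL0 hc n).trans hinit
  rw [inv_eq_one_div, le_div_iff₀' hc]
  exact this

/-- The line-crossing inequality for a sub-`ψ` process. -/
lemma IsSubPsi.measure_crossing_le {Λ : EReal} {ψ : ℝ → ℝ} {S V : ℕ → Ω → ℝ}
    (hS : IsSubPsi μ ℱ Λ ψ S V) {l : ℝ} (hl : l ∈ dom Λ) (x : ℝ) :
    μ {ω | ∃ t, x ≤ l * S t ω - ψ l * V t ω} ≤ ENNReal.ofReal (Real.exp (-x)) := by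
  obtain ⟨L, hL, hL0, hinit, hdom⟩ := hS.dominated l hl
  rw [Real.exp_neg]
  refine le_trans (measure_mono_ae ?_)
    (supermartingale_maximal_ineq hL hL0 hinit (Real.exp_pos x))
  filter_upwards [ae_all_iff.2 hdom] with ω hω
  rintro ⟨t, ht⟩
  exact ⟨t, (Real.exp_le_exp.2 ht).trans (hω t)⟩

end Maximal

/-! ### Nets of the Euclidean sphere -/

section Net

lemma pow_succ_sub_pow_succ_le {a b : ℝ} (hb : 0 ≤ b) (hab : b ≤ a) (n : ℕ) :
    a ^ (n + 1) - b ^ (n + 1) ≤ (n + 1) * (a - b) * a ^ n := by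
  induction n with
  | zero => simp
  | succ n ih =>
    have h1 : b ^ (n + 1) ≤ a ^ (n + 1) := pow_le_pow_left₀ hb hab _
    have h2 := mul_le_mul_of_nonneg_left ih (hb.trans hab)
    have h3 := mul_le_mul_of_nonneg_left h1 (sub_nonneg.2 hab)
    push_cast
    have e1 : a ^ (n + 1 + 1) = a * a ^ (n + 1) := by ring
    have e2 : b ^ (n + 1 + 1) = b * b ^ (n + 1) := by ring
    have e3 : a * ((n + 1) * (a - b) * a ^ n) = (n + 1) * ((a - b) * a ^ (n + 1)) := by ring
    rw [e3] at h2
    rw [e1, e2]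
    nlinarith

/-- A separated subset of the unit sphere is small, by comparison of volumes. -/
lemma card_le_of_separated {d : ℕ} (hd : 1 ≤ d) {η : ℝ} (hη : 0 < η) (hη1 : η ≤ 1)
    (T : Finset (EuclideanSpace ℝ (Fin d))) (hT : ∀ x ∈ T, ‖x‖ = 1)
    (hsep : (T : Set (EuclideanSpace ℝ (Fin d))).Pairwise fun x y => η ≤ dist x y) :
    (T.card : ℝ) ≤ 2 * d * (3 / η) ^ (d - 1) := by
  obtain ⟨n, rfl⟩ : ∃ n, d = n + 1 := ⟨d - 1, by omega⟩
  let E := EuclideanSpace ℝ (Fin (n + 1))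
  let v := (volume : Measure E).real (Metric.ball 0 1)
  have hv : 0 < v := ENNReal.toReal_pos (Metric.measure_ball_pos _ _ one_pos).ne'
    measure_ball_lt_top.ne
  have hvol : ∀ (x : E) (r : ℝ), 0 ≤ r →
      (volume : Measure E).real (Metric.ball x r) = r ^ (n + 1) * v := fun x r hr => by
    have h := Measure.addHaar_ball (volume : Measure E) x hr
    have hf : Module.finrank ℝ E = n + 1 := finrank_euclideanSpace_fin
    rw [measureReal_def, h, hf, ENNReal.toReal_mul, ENNReal.toReal_ofReal (by positivity)]
    rfl
  have hdisj : (T : Set E).PairwiseDisjoint fun x => Metric.ball x (η / 2) :=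
    fun x hx y hy hxy => Metric.ball_disjoint_ball (by linarith [hsep hx hy hxy])
  have hunion : (volume : Measure E).real (⋃ x ∈ T, Metric.ball x (η / 2))
      = T.card * ((η / 2) ^ (n + 1) * v) := by
    rw [measureReal_biUnion_finset hdisj (fun _ _ => measurableSet_ball)
      (fun _ _ => measure_ball_lt_top.ne)]
    simp [hvol _ _ (half_pos hη).le]
  -- The small balls lie in a shell of thickness `η`. Discarding the inner ball saves one power of
  -- `1 / η`, whence the exponent `d - 1`.
  have hdisj2 : Disjoint (⋃ x ∈ T, Metric.ball x (η / 2)) (Metric.ball (0 : E) (1 - η / 2)) := by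
    rw [disjoint_iUnion₂_left]
    intro x hx
    refine Metric.ball_disjoint_ball ?_
    rw [dist_zero_right, hT x hx]; linarith
  have hsub : (⋃ x ∈ T, Metric.ball x (η / 2)) ∪ Metric.ball (0 : E) (1 - η / 2)
      ⊆ Metric.ball 0 (1 + η / 2) := by
    refine union_subset (iUnion₂_subset fun x hx => ?_) (Metric.ball_subset_ball (by linarith))
    refine Metric.ball_subset_ball' ?_
    rw [dist_zero_right, hT x hx]; linarith
  have hle := measureReal_mono hsub (μ := (volume : Measure E)) measure_ball_lt_top.ne
  rw [measureReal_union hdisj2 measurableSet_ball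
    ((measure_mono (subset_union_left.trans hsub)).trans_lt measure_ball_lt_top).ne
    measure_ball_lt_top.ne, hunion, hvol _ _ (by linarith), hvol _ _ (by linarith)] at hle
  have h1 : (T.card : ℝ) * (η / 2) ^ (n + 1) ≤ (1 + η / 2) ^ (n + 1) - (1 - η / 2) ^ (n + 1) := by
    refine le_of_mul_le_mul_right ?_ hv
    linarith
  have h2 := h1.trans (pow_succ_sub_pow_succ_le (by linarith) (by linarith) n)
  have h3 : (1 + η / 2) ^ n ≤ (3 / 2 : ℝ) ^ n := by gcongr; linarith
  have h4 : (T.card : ℝ) * (η / 2) ^ (n + 1) ≤ (n + 1) * η * (3 / 2) ^ n := by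
    refine h2.trans ?_
    have : 1 + η / 2 - (1 - η / 2) = η := by ring
    rw [this]; gcongr
  rw [← le_div_iff₀ (by positivity)] at h4
  refine h4.trans (le_of_eq ?_)
  simp only [Nat.cast_add, Nat.cast_one, Nat.add_sub_cancel, div_pow]
  field_simp
  ring

/-- A net of the unit sphere of `ℝᵈ`. -/
lemma exists_sphere_net {d : ℕ} (hd : 1 ≤ d) {η : ℝ} (hη : 0 < η) (hη1 : η ≤ 1) :
    ∃ T : Finset (EuclideanSpace ℝ (Fin d)), (∀ x ∈ T, ‖x‖ = 1) ∧
      (∀ x, ‖x‖ = 1 → ∃ y ∈ T, ‖y - x‖ ≤ η) ∧ (T.card : ℝ) ≤ 2 * d * (3 / η) ^ (d - 1) := by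
  set A : Set (EuclideanSpace ℝ (Fin d)) := Metric.sphere 0 1
  set e : NNReal := ⟨η, hη.le⟩
  have hfin : ∀ C ⊆ A, Metric.IsSeparated e C → ∀ T : Finset (EuclideanSpace ℝ (Fin d)),
      (T : Set _) ⊆ C → (T.card : ℝ) ≤ 2 * d * (3 / η) ^ (d - 1) := by
    intro C hCA hC T hTC
    refine card_le_of_separated hd hη hη1 T (fun x hx => by simpa [A] using hCA (hTC hx)) ?_
    intro x hx y hy hxy
    have h : (e : ENNReal) < edist x y := hC (hTC hx) (hTC hy) hxy
    rw [edist_dist] at h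
    have h' : ENNReal.ofReal η < ENNReal.ofReal (dist x y) := by
      rwa [show ENNReal.ofReal η = (e : ENNReal) from ENNReal.ofReal_eq_coe_nnreal hη.le]
    exact (ENNReal.ofReal_lt_ofReal_iff_of_nonneg hη.le).1 h' |>.le
  -- Finite packing is needed before a maximal separated set can be used as a cover.
  have hpack : Metric.packingNumber e A ≠ ⊤ := by
    set M := ⌊(2 * d * (3 / η) ^ (d - 1) : ℝ)⌋₊
    refine ne_top_of_le_ne_top (ENat.natCast_ne_top M) ?_
    refine iSup_le fun C => iSup_le fun hCA => iSup_le fun hC => ?_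
    by_contra! hlt
    obtain ⟨T, hTC, hT⟩ := Set.exists_subset_encard_eq (s := C) (k := (M + 1 : ℕ))
      (by push_cast; exact Order.add_one_le_of_lt hlt)
    have hTf : T.Finite := Set.finite_of_encard_eq_coe hT
    have h1 := hfin C hCA hC hTf.toFinset (by simpa using hTC)
    have h2 : hTf.toFinset.card = M + 1 := by
      have := hTf.encard_eq_coe_toFinset_card
      rw [hT] at this
      exact_mod_cast this.symm
    rw [h2] at h1
    have := Nat.le_floor h1
    omega
  have hne : (Metric.maximalSeparatedSet e A).Finite := by
    rw [← Set.encard_ne_top_iff, Metric.encard_maximalSeparatedSet hpack]; exact hpack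
  refine ⟨hne.toFinset, fun x hx => ?_, fun x hx => ?_, ?_⟩
  · have := Metric.maximalSeparatedSet_subset (hne.mem_toFinset.1 hx)
    simpa [A] using this
  · obtain ⟨y, hy, hxy⟩ := Metric.isCover_maximalSeparatedSet hpack (x := x) (by simpa [A] using hx)
    refine ⟨y, by simpa using hy, ?_⟩
    rw [← dist_eq_norm, dist_comm]
    have h : edist x y ≤ e := hxy
    rw [edist_dist, show (e : ENNReal) = ENNReal.ofReal η from
      (ENNReal.ofReal_eq_coe_nnreal hη.le).symm] at h
    exact (ENNReal.ofReal_le_ofReal_iff hη.le).1 h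
  · exact hfin _ Metric.maximalSeparatedSet_subset Metric.isSeparated_maximalSeparatedSet _ (by simp)

/-- The Euclidean ball sits inside the sup-norm ball, so the volume ratio is at least one. The net
above has prefactor `2d`, so nothing more about `C_d` is needed. -/
lemma two_mul_le_coverConst (d : ℕ) : 2 * (d : ℝ) ≤ coverConst d := by
  refine le_mul_of_one_le_right (by positivity) ?_
  rw [one_le_div]
  · have hsub : Metric.closedBall (0 : EuclideanSpace ℝ (Fin (d - 1))) 1 ⊆
        (WithLp.ofLp ⁻¹' Metric.closedBall (0 : Fin (d - 1) → ℝ) 1) := by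
      intro x hx
      simp only [mem_preimage, mem_closedBall_zero_iff] at hx ⊢
      rw [pi_norm_le_iff_of_nonneg zero_le_one]
      exact fun i => (PiLp.norm_apply_le x i).trans hx
    rw [← (PiLp.volume_preserving_ofLp (Fin (d - 1))).measure_preimage
      measurableSet_closedBall.nullMeasurableSet] 
    refine ENNReal.toReal_mono ?_ (measure_mono hsub)
    rw [(PiLp.volume_preserving_ofLp (Fin (d - 1))).measure_preimage
      measurableSet_closedBall.nullMeasurableSet]
    exact measure_closedBall_lt_top.ne
  · exact ENNReal.toReal_pos (Metric.measure_closedBall_pos _ _ one_pos).ne'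
      measure_closedBall_lt_top.ne

end Net

/-! ### Quadratic forms, clipping and the choice of direction -/

section Spectral

variable {d : ℕ} {A : Matrix (Fin d) (Fin d) ℝ}

lemma act_mul (A B : Matrix (Fin d) (Fin d) ℝ) (x : EuclideanSpace ℝ (Fin d)) :
    act (A * B) x = act A (act B x) := by
  simp [act, map_mul]

lemma inner_act_right (hA : A.IsHermitian) (x y : EuclideanSpace ℝ (Fin d)) :
    inner ℝ x (act A y) = inner ℝ (act A x) y := by
  have : ContinuousLinearMap.adjoint (Matrix.toEuclideanCLM (𝕜 := ℝ) A)
      = Matrix.toEuclideanCLM (𝕜 := ℝ) A := by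
    rw [← ContinuousLinearMap.star_eq_adjoint, ← map_star]
    congr 1
  conv_rhs => rw [act, ← this, ContinuousLinearMap.adjoint_inner_left]

lemma act_cfc_eigenvector (hA : A.IsHermitian) (f : ℝ → ℝ) (i : Fin d) :
    act (cfc f A) (hA.eigenvectorBasis i) = f (hA.eigenvalues i) • hA.eigenvectorBasis i := by
  apply WithLp.ofLp_injective
  rw [act, Matrix.ofLp_toEuclideanCLM, hA.cfc_eq, Matrix.IsHermitian.cfc,
    Unitary.conjStarAlgAut_apply, ← Matrix.mulVec_mulVec, ← Matrix.mulVec_mulVec,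
    hA.star_eigenvectorUnitary_mulVec, Matrix.diagonal_mulVec_single]
  have h : ∀ c : ℝ, (Pi.single i (c * 1) : Fin d → ℝ) = c • Pi.single i 1 := fun c => by
    rw [← Pi.single_smul, smul_eq_mul]
  rw [h, Matrix.mulVec_smul, hA.eigenvectorUnitary_mulVec]
  rfl

/-- The eigenbasis of `A` diagonalizes every `cfc f A`, so comparing quadratic forms reduces to
comparing scalar functions on the eigenvalues. -/
lemma inner_act_cfc (hA : A.IsHermitian) (f : ℝ → ℝ) (x : EuclideanSpace ℝ (Fin d)) :
    inner ℝ x (act (cfc f A) x)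
      = ∑ i, f (hA.eigenvalues i) * (inner ℝ (hA.eigenvectorBasis i) x) ^ 2 := by
  have hf : (cfc f A).IsHermitian := IsSelfAdjoint.isHermitian (cfc_predicate f A)
  rw [← hA.eigenvectorBasis.sum_inner_mul_inner]
  refine Finset.sum_congr rfl fun i _ => ?_
  rw [inner_act_right hf, act_cfc_eigenvector, inner_smul_left, real_inner_comm]
  simp only [conj_trivial]; ring

lemma norm_sq_eq_sum (hA : A.IsHermitian) (x : EuclideanSpace ℝ (Fin d)) :
    ‖x‖ ^ 2 = ∑ i, (inner ℝ (hA.eigenvectorBasis i) x) ^ 2 := by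
  have := hA.eigenvectorBasis.sum_sq_norm_inner_right x
  simpa using this.symm

lemma cfc_id_of_isHermitian (hA : A.IsHermitian) : cfc (fun x : ℝ => x) A = A :=
  cfc_id' ℝ A (ha := hA)

lemma gmin_mul_le (hA : A.IsHermitian) (x : EuclideanSpace ℝ (Fin d)) :
    gmin A * ‖x‖ ^ 2 ≤ inner ℝ x (act A x) := by
  conv_rhs => rw [← cfc_id_of_isHermitian hA]
  rw [inner_act_cfc hA, norm_sq_eq_sum hA, Finset.mul_sum]
  refine Finset.sum_le_sum fun i _ => mul_le_mul_of_nonneg_right ?_ (sq_nonneg _)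
  exact csInf_le A.finite_real_spectrum.bddBelow (hA.eigenvalues_mem_spectrum_real i)

lemma le_gmax_mul (hA : A.IsHermitian) (x : EuclideanSpace ℝ (Fin d)) :
    inner ℝ x (act A x) ≤ gmax A * ‖x‖ ^ 2 := by
  conv_lhs => rw [← cfc_id_of_isHermitian hA]
  rw [inner_act_cfc hA, norm_sq_eq_sum hA, Finset.mul_sum]
  refine Finset.sum_le_sum fun i _ => mul_le_mul_of_nonneg_right ?_ (sq_nonneg _)
  exact le_csSup A.finite_real_spectrum.bddAbove (hA.eigenvalues_mem_spectrum_real i)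

lemma spectrum_nonempty (hd : 1 ≤ d) (hA : A.IsHermitian) : (spectrum ℝ A).Nonempty :=
  ⟨_, hA.eigenvalues_mem_spectrum_real ⟨0, hd⟩⟩

lemma gmin_le_gmax (hd : 1 ≤ d) (hA : A.IsHermitian) : gmin A ≤ gmax A :=
  csInf_le_csSup (spectrum_nonempty hd hA) A.finite_real_spectrum.bddBelow
    A.finite_real_spectrum.bddAbove

lemma isHermitian_clip (A : Matrix (Fin d) (Fin d) ℝ) (ρ : ℝ) : (clip A ρ).IsHermitian :=
  IsSelfAdjoint.isHermitian (cfc_predicate _ A)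

lemma le_of_mem_spectrum_clip (hA : A.IsHermitian) {ρ x : ℝ} (hx : x ∈ spectrum ℝ (clip A ρ)) :
    ρ ≤ x := by
  obtain ⟨y, -, rfl⟩ := (cfc_map_spectrum (R := ℝ) (fun x : ℝ => max x ρ) A (ha := hA)).subset hx
  exact le_max_right _ _

lemma le_gmin_clip (hd : 1 ≤ d) (hA : A.IsHermitian) (ρ : ℝ) : ρ ≤ gmin (clip A ρ) :=
  le_csInf (spectrum_nonempty hd (isHermitian_clip A ρ)) fun _ => le_of_mem_spectrum_clip hA

lemma inner_act_le_clip (hA : A.IsHermitian) (ρ : ℝ) (x : EuclideanSpace ℝ (Fin d)) :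
    inner ℝ x (act A x) ≤ inner ℝ x (act (clip A ρ) x) := by
  conv_lhs => rw [← cfc_id_of_isHermitian hA]
  rw [clip, inner_act_cfc hA, inner_act_cfc hA]
  exact Finset.sum_le_sum fun i _ => mul_le_mul_of_nonneg_right (le_max_left _ _) (sq_nonneg _)

/-- A positive definite matrix has a symmetric square root inverse to `invSqrt`. -/
lemma exists_sqrt (hA : A.IsHermitian) (hpos : ∀ x ∈ spectrum ℝ A, 0 < x) :
    ∃ B : Matrix (Fin d) (Fin d) ℝ, B.IsHermitian ∧ B * B = A ∧ B * invSqrt A = 1 := by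
  refine ⟨cfc Real.sqrt A, IsSelfAdjoint.isHermitian (cfc_predicate _ A), ?_, ?_⟩
  · rw [← cfc_mul Real.sqrt Real.sqrt A]
    conv_rhs => rw [← cfc_id_of_isHermitian hA]
    exact cfc_congr fun x hx => Real.mul_self_sqrt (hpos x hx).le
  · rw [invSqrt, ← cfc_mul Real.sqrt (fun x => (√x)⁻¹) A
      (hg := A.finite_real_spectrum.continuousOn _)]
    rw [← cfc_one ℝ A (ha := hA)]
    exact cfc_congr fun x hx => mul_inv_cancel₀ (Real.sqrt_pos.2 (hpos x hx)).ne'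

/-- If `y` is close to `p` relative to the size of `p`, the two have almost the same direction. -/
lemma le_inner_of_norm_sub_le {E : Type*} [NormedAddCommGroup E] [InnerProductSpace ℝ E]
    {y p : E} {ε : ℝ} (hε : 0 ≤ ε) (hε' : ε ≤ 1) (h : ‖y - p‖ ≤ ε * ‖p‖) :
    (1 - ε) * (‖y‖ * ‖p‖) ≤ inner ℝ y p := by
  have h1 : ‖y - p‖ ^ 2 ≤ (ε * ‖p‖) ^ 2 := by gcongr
  rw [norm_sub_sq_real] at h1
  -- Expanding gives `2⟨y, p⟩ ≥ ‖y‖² + (1 - ε²)‖p‖²`; the first square bounds `‖y‖²` below, leaving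
  -- the surplus `2ε(1 - ε)‖p‖²`.
  nlinarith [sq_nonneg (‖y‖ - (1 - ε) * ‖p‖), mul_nonneg (mul_nonneg hε (sub_nonneg.2 hε'))
    (sq_nonneg ‖p‖)]

/-- One of the directions of a net of mesh `ε (γ_min / γ_max)^{1/2}` nearly attains
`‖W^{-1/2} s‖`. -/
lemma exists_direction {W : Matrix (Fin d) (Fin d) ℝ} (hW : W.IsHermitian)
    (hpos : ∀ x ∈ spectrum ℝ W, 0 < x) (hg : 0 < gmin W) {ε η : ℝ} (hε : 0 < ε) (hε' : ε < 1)
    (hη : √(gmax W) * η ≤ ε * √(gmin W)) {T : Finset (EuclideanSpace ℝ (Fin d))}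
    (hT : ∀ x, ‖x‖ = 1 → ∃ y ∈ T, ‖y - x‖ ≤ η) {s : EuclideanSpace ℝ (Fin d)}
    (hs : 0 < ‖act (invSqrt W) s‖) :
    ∃ y ∈ T, (1 - ε) * (√(inner ℝ y (act W y)) * ‖act (invSqrt W) s‖) ≤ inner ℝ y s := by
  obtain ⟨B, hB, hBB, hBi⟩ := exists_sqrt hW hpos
  have hnorm : ∀ x, inner ℝ x (act W x) = ‖act B x‖ ^ 2 := fun x => by
    rw [← hBB, act_mul, inner_act_right hB, real_inner_self_eq_norm_sq]
  have hBinv : ∀ x, act B (act (invSqrt W) x) = x := fun x => by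
    rw [← act_mul, hBi]; simp [act]
  have hup : ∀ x, ‖act B x‖ ≤ √(gmax W) * ‖x‖ := fun x => by
    refine abs_le_of_sq_le_sq' ?_ (by positivity) |>.2
    have h0 := (gmin_mul_le hW x).trans (le_gmax_mul hW x)
    rcases eq_or_ne x 0 with rfl | hx
    · simp [act]
    have hx' : 0 < ‖x‖ ^ 2 := by positivity
    have h1 : 0 ≤ gmax W := hg.le.trans (le_of_mul_le_mul_right h0 hx')
    rw [mul_pow, Real.sq_sqrt h1, ← hnorm]
    exact le_gmax_mul hW x
  have hlow : ∀ x, √(gmin W) * ‖x‖ ≤ ‖act B x‖ := fun x => by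
    refine abs_le_of_sq_le_sq' ?_ (by positivity) |>.2
    rw [mul_pow, Real.sq_sqrt hg.le, ← hnorm]
    exact gmin_mul_le hW x
  set x := act (invSqrt W) s with hx
  -- `z = W⁻¹s` is the ideal direction, because `B z = x`. The net approximates `z / ‖z‖`; applying
  -- `B` costs `√γ_max`, and the image has norm at least `√γ_min`.
  set z := act (invSqrt W) x
  have hBz : act B z = x := hBinv x
  have hz : 0 < ‖z‖ := by
    rw [norm_pos_iff]
    rintro h0
    rw [h0] at hBz
    simp [act] at hBz
    rw [← hBz] at hs
    simp at hs
  obtain ⟨y, hyT, hy⟩ := hT (‖z‖⁻¹ • z) (by rw [norm_smul, norm_inv, norm_norm]; field_simp)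
  refine ⟨y, hyT, ?_⟩
  have hp : act B (‖z‖⁻¹ • z) = ‖z‖⁻¹ • x := by rw [act, map_smul]; exact congrArg _ hBz
  have hclose : ‖act B y - ‖z‖⁻¹ • x‖ ≤ ε * ‖‖z‖⁻¹ • x‖ := by
    rw [← hp, act, act, ← map_sub]
    calc _ ≤ √(gmax W) * ‖y - ‖z‖⁻¹ • z‖ := hup _
      _ ≤ √(gmax W) * η := by gcongr
      _ ≤ ε * √(gmin W) := hη
      _ = ε * (√(gmin W) * ‖‖z‖⁻¹ • z‖) := by
          rw [norm_smul, norm_inv, norm_norm, inv_mul_cancel₀ hz.ne', mul_one]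
      _ ≤ _ := by gcongr; exact hlow _
  have h := le_inner_of_norm_sub_le hε.le hε'.le hclose
  rw [norm_smul, norm_inv, norm_norm, inner_smul_right] at h
  have h' : (1 - ε) * (‖act B y‖ * ‖x‖) ≤ inner ℝ (act B y) x := by
    refine le_of_mul_le_mul_left ?_ (inv_pos.2 hz)
    linarith
  rw [hnorm, Real.sqrt_sq (norm_nonneg _)]
  rw [← inner_act_right hB, hx, hBinv] at h'
  exact h'

end Spectral

/-! ### Stitching over condition number, variance and direction -/

section Bound

/-- The crossing level at stage `j` of the condition number and stage `k` of the variance, when the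
directions range over a net of `N` points. -/
noncomputable def level (β δ : ℝ) (h : ℝ → ℝ) (N j k : ℕ) : ℝ :=
  Real.log (h k) + Real.log (N * β ^ j / (δ * (1 - β⁻¹)))

lemma one_le_of_tsum_inv_le {h : ℝ → ℝ} (hpos : ∀ k : ℕ, 0 < h k)
    (hsummable : Summable (fun k : ℕ => (h k)⁻¹)) (hsum : ∑' k : ℕ, (h k)⁻¹ ≤ 1) (k : ℕ) :
    1 ≤ h k := by
  have := (hsummable.le_tsum k fun i _ => (inv_pos.2 (hpos i)).le).trans hsum
  exact (inv_le_one₀ (hpos k)).1 this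

lemma exp_neg_level {β δ : ℝ} (hβ : 1 < β) (hδ : 0 < δ) {h : ℝ → ℝ} (hpos : ∀ k : ℕ, 0 < h k)
    {N : ℕ} (hN : 0 < N) (j k : ℕ) :
    Real.exp (-level β δ h N j k) = δ * (1 - β⁻¹) * (β⁻¹) ^ j * (h k)⁻¹ / N := by
  have hβ0 : 0 < β := one_pos.trans hβ
  have hβ1 : 0 < 1 - β⁻¹ := sub_pos.2 (inv_lt_one_of_one_lt₀ hβ)
  have := hpos k
  rw [level, ← Real.log_mul (by positivity) (by positivity), ← Real.log_inv, Real.exp_log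
    (by positivity), inv_pow]
  field_simp

lemma level_pos {β δ : ℝ} (hβ : 1 < β) (hδ : 0 < δ) (hδ' : δ < 1) {h : ℝ → ℝ}
    (hh : ∀ k : ℕ, 1 ≤ h k) {N : ℕ} (hN : 0 < N) (j k : ℕ) : 0 < level β δ h N j k := by
  have hβ0 : 0 < β := one_pos.trans hβ
  have hβ1 : 0 < 1 - β⁻¹ := sub_pos.2 (inv_lt_one_of_one_lt₀ hβ)
  have hβ2 : 0 < β⁻¹ := inv_pos.2 hβ0
  refine add_pos_of_nonneg_of_pos (Real.log_nonneg (hh k)) (Real.log_pos ?_)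
  rw [one_lt_div (by positivity)]
  have h1 : δ * (1 - β⁻¹) < 1 := by nlinarith
  have h2 : (1 : ℝ) ≤ N * β ^ j :=
    one_le_mul_of_one_le_of_one_le (by exact_mod_cast hN) (one_le_pow₀ hβ.le)
  linarith

/-- The net contributes `d - 1` factors `3βr / ε`, and `β^j ≤ r` is absorbed by one more. -/
lemma log_card_le {β δ ε r : ℝ} (hβ : 1 < β) (hδ : 0 < δ) (hε : 0 < ε) (hε' : ε < 1) {d N j : ℕ}
    (hd : 1 ≤ d) (hN : 0 < N) (hNd : (N : ℝ) ≤ 2 * d * (3 / (ε / β ^ (j + 1))) ^ (d - 1))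
    (hr : β ^ j ≤ r) :
    Real.log (N * β ^ j / (δ * (1 - β⁻¹)))
      ≤ Real.log (coverConst d / (δ * (1 - β⁻¹))) + d * Real.log (3 * β * r / ε) := by
  have hβ0 : 0 < β := one_pos.trans hβ
  have hβ1 : 0 < 1 - β⁻¹ := sub_pos.2 (inv_lt_one_of_one_lt₀ hβ)
  have hd0 : (0 : ℝ) < d := by exact_mod_cast hd
  have hC := two_mul_le_coverConst d
  have hC0 : 0 < coverConst d := by linarith
  have hr0 : 0 < r := (pow_pos hβ0 j).trans_le hr
  rw [← Real.log_pow, ← Real.log_mul (by positivity) (by positivity)]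
  refine Real.log_le_log (by positivity) ?_
  rw [div_mul_eq_mul_div]
  gcongr ?_ / _
  have h1 : 3 / (ε / β ^ (j + 1)) ≤ 3 * β * r / ε := by
    rw [div_div_eq_mul_div, pow_succ]
    gcongr ?_ / _
    nlinarith
  have h2 : β ^ j ≤ 3 * β * r / ε := by
    rw [le_div_iff₀ hε]
    calc β ^ j * ε ≤ r * 1 := by gcongr
      _ ≤ 3 * β * r := by nlinarith
  calc (N : ℝ) * β ^ j ≤ coverConst d * (3 * β * r / ε) ^ (d - 1) * (3 * β * r / ε) := by
        gcongr
        exact hNd.trans (by gcongr)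
    _ = _ := by rw [mul_assoc, ← pow_succ, Nat.sub_add_cancel hd]

/-- If the self-normalized norm exceeds the boundary then some direction of some net crosses its
line. -/
lemma exists_crossing {α β ρ ε δ : ℝ} (hα : 1 < α) (hβ : 1 < β) (hρ : 0 < ρ) (hε : 0 < ε)
    (hε' : ε < 1) (hδ : 0 < δ) (hδ' : δ < 1) {h : ℝ → ℝ} (hmono : MonotoneOn h (Set.Ici 0))
    (hh : ∀ k : ℕ, 1 ≤ h k) {d : ℕ} (hd : 1 ≤ d) {Λ : EReal} {ψ : ℝ → ℝ}
    (hψ : IsCGFLike Λ ψ) (hu : HasUnboundedDeriv Λ ψ) (hs : IsSuperGaussian Λ ψ)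
    {T : ℕ → Finset (EuclideanSpace ℝ (Fin d))} (hT1 : ∀ j, ∀ x ∈ T j, ‖x‖ = 1)
    (hT : ∀ j x, ‖x‖ = 1 → ∃ y ∈ T j, ‖y - x‖ ≤ ε / β ^ (j + 1))
    (hTc : ∀ j, ((T j).card : ℝ) ≤ 2 * d * (3 / (ε / β ^ (j + 1))) ^ (d - 1))
    {l : ℕ → ℕ → ℝ} (hl : ∀ j k, l j k ∈ dom Λ)
    (hlI : ∀ j k, (T j).Nonempty → conjInv Λ ψ (level β δ h (T j).card j k / (ρ * α ^ k)) * l j k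
      = level β δ h (T j).card j k / (ρ * α ^ k) + ψ (l j k))
    {V : Matrix (Fin d) (Fin d) ℝ} (hV : V.IsHermitian) {s : EuclideanSpace ℝ (Fin d)}
    (hbound : √(gmin (clip V ρ)) / (1 - ε) *
      conjInv Λ ψ (α / gmin (clip V ρ) * Lcov α β ρ ε δ h V) ≤ ‖act (invSqrt (clip V ρ)) s‖) :
    ∃ j k, ∃ ν ∈ T j, level β δ h (T j).card j k
      ≤ l j k * inner ℝ ν s - ψ (l j k) * inner ℝ ν (act V ν) := by
  set W := clip V ρ with hWdef
  have hW : W.IsHermitian := isHermitian_clip V ρ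
  have hpos : ∀ x ∈ spectrum ℝ W, 0 < x := fun x hx => hρ.trans_le (le_of_mem_spectrum_clip hV hx)
  have hgρ : ρ ≤ gmin W := le_gmin_clip hd hV ρ
  have hg : 0 < gmin W := hρ.trans_le hgρ
  have hgg : gmin W ≤ gmax W := gmin_le_gmax hd hW
  have hG : 0 < gmax W := hg.trans_le hgg
  have hα0 : 0 < α := one_pos.trans hα
  have hβ0 : 0 < β := one_pos.trans hβ
  have hκ : 1 ≤ √(cond W) := Real.one_le_sqrt.2 ((one_le_div hg).2 hgg)
  have hκs : √(gmax W) = √(cond W) * √(gmin W) := by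
    rw [← Real.sqrt_mul' _ hg.le, cond, div_mul_cancel₀ _ hg.ne']
  obtain ⟨j, hj, hj'⟩ := exists_nat_pow_near hκ hβ
  have hTne : (T j).Nonempty := by
    have : Nonempty (Fin d) := ⟨⟨0, hd⟩⟩
    obtain ⟨x, hx⟩ := exists_norm_eq (EuclideanSpace ℝ (Fin d)) zero_le_one
    obtain ⟨y, hy, -⟩ := hT j x hx
    exact ⟨y, hy⟩
  have hcard : 0 < (T j).card := hTne.card_pos
  have hx0 : 0 ≤ Real.logb α (gmax W / ρ) :=
    Real.logb_nonneg hα ((one_le_div hρ).2 (hgρ.trans hgg))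
  have hlev : ∀ k : ℕ, ρ * α ^ k ≤ gmax W →
      level β δ h (T j).card j k ≤ Lcov α β ρ ε δ h V := by
    intro k hk
    rw [level, Lcov, add_assoc]
    refine add_le_add ?_ (log_card_le hβ hδ hε hε' hd hcard (hTc j) hj)
    refine Real.log_le_log (one_pos.trans_le (hh k)) (hmono (mem_Ici.2 (Nat.cast_nonneg k)) hx0 ?_)
    rw [Real.le_logb_iff_rpow_le hα (by positivity), Real.rpow_natCast, le_div_iff₀' hρ]
    exact hk
  have hL : 0 < Lcov α β ρ ε δ h V :=
    (level_pos hβ hδ hδ' hh hcard j 0).trans_le (hlev 0 (by simpa using hgρ.trans hgg))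
  set L := Lcov α β ρ ε δ h V
  have hb0 : 0 < √(gmin W) / (1 - ε) * conjInv Λ ψ (α / gmin W * L) :=
    mul_pos (div_pos (Real.sqrt_pos.2 hg) (by linarith))
      (hψ.conjInv_spec hu (by positivity)).1
  obtain ⟨ν, hν, hνs⟩ := exists_direction hW hpos hg hε hε' (η := ε / β ^ (j + 1)) (by
    rw [hκs, mul_div_assoc', div_le_iff₀ (by positivity)]
    have := mul_le_mul_of_nonneg_left hj'.le (mul_nonneg hε.le (Real.sqrt_nonneg (gmin W)))
    linarith) (hT j) (hb0.trans_le hbound)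
  have hν1 := hT1 j ν hν
  set m := inner ℝ ν (act W ν)
  have hgm : gmin W ≤ m := by have := gmin_mul_le hW ν; rwa [hν1, one_pow, mul_one] at this
  have hmG : m ≤ gmax W := by have := le_gmax_mul hW ν; rwa [hν1, one_pow, mul_one] at this
  have hm : 0 < m := hg.trans_le hgm
  have hvm : inner ℝ ν (act V ν) ≤ m := inner_act_le_clip hV ρ ν
  -- The variance stage is read off from `m`, the variance in direction `ν`, and not from `γ_max`.
  -- Replacing `m` by `ρα^k` loses at most the factor `α` in the boundary.
  obtain ⟨k, hk, hk'⟩ := exists_nat_pow_near ((one_le_div hρ).2 (hgρ.trans hgm)) hα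
  rw [le_div_iff₀' hρ] at hk
  rw [div_lt_iff₀' hρ] at hk'
  refine ⟨j, k, ν, hν, ?_⟩
  set x := level β δ h (T j).card j k
  have hxL : x ≤ L := hlev k (hk.trans hmG)
  have hx : 0 < x := level_pos hβ hδ hδ' hh hcard j k
  set c := x / (ρ * α ^ k)
  have hc : 0 < c := by positivity
  have hcL : c ≤ α * L / m := by
    rw [div_le_div_iff₀ (by positivity) hm]
    calc x * m ≤ L * (ρ * α ^ (k + 1)) := by gcongr
      _ = _ := by ring
  have h1 : √m * (√(gmin W) * conjInv Λ ψ (α * L / gmin W)) ≤ inner ℝ ν s := by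
    refine le_trans ?_ hνs
    have h2 : √(gmin W) * conjInv Λ ψ (α * L / gmin W)
        ≤ (1 - ε) * ‖act (invSqrt W) s‖ := by
      rw [div_mul_eq_mul_div, div_le_iff₀ (by linarith), div_mul_eq_mul_div] at hbound
      linarith
    have := mul_le_mul_of_nonneg_left h2 (Real.sqrt_nonneg m)
    linarith
  have h2 : m * conjInv Λ ψ c ≤ inner ℝ ν s := by
    refine le_trans ?_ h1
    have h3 := hψ.sqrt_mul_conjInv_anti hu hs (c := α * L) (by positivity) hg hgm
    have h4 := hψ.conjInv_mono hu hc hcL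
    calc m * conjInv Λ ψ c = √m * (√m * conjInv Λ ψ c) := by
          rw [← mul_assoc, Real.mul_self_sqrt hm.le]
      _ ≤ √m * (√m * conjInv Λ ψ (α * L / m)) := by gcongr
      _ ≤ _ := by gcongr
  have h3 := mul_le_mul_of_nonneg_left h2 (hl j k).1
  have h4 := hlI j k hTne
  have h5 := hψ.nonneg _ (hl j k)
  -- Here `ρα^k ≤ m` is used; the upper end `m < ρα^(k+1)` was used in `hcL`.
  have h6 : x ≤ m * c := by
    rw [mul_div_assoc', le_div_iff₀ (by positivity)]
    nlinarith
  have h7 := mul_le_mul_of_nonneg_left hvm h5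
  have h8 : l j k * (m * conjInv Λ ψ c) = m * c + m * ψ (l j k) := by
    rw [← mul_add, ← h4]; ring
  linarith

lemma tsum_tsum_weight_le {β δ : ℝ} (hβ : 1 < β) (hδ : 0 < δ) {h : ℝ → ℝ}
    (hpos : ∀ k : ℕ, 0 < h k) (hsummable : Summable (fun k : ℕ => (h k)⁻¹))
    (hsum : ∑' k : ℕ, (h k)⁻¹ ≤ 1) :
    ∑' j : ℕ, ∑' k : ℕ, ENNReal.ofReal (δ * (1 - β⁻¹) * (β⁻¹) ^ j * (h k)⁻¹)
      ≤ ENNReal.ofReal δ := by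
  have hβ0 : 0 < β⁻¹ := inv_pos.2 (one_pos.trans hβ)
  have hβ2 : β⁻¹ < 1 := inv_lt_one_of_one_lt₀ hβ
  have hβ1 : 0 < 1 - β⁻¹ := sub_pos.2 hβ2
  have hk : ∀ j : ℕ, ∑' k : ℕ, ENNReal.ofReal (δ * (1 - β⁻¹) * (β⁻¹) ^ j * (h k)⁻¹)
      ≤ ENNReal.ofReal (δ * (1 - β⁻¹) * (β⁻¹) ^ j) := by
    intro j
    have h0 : 0 ≤ δ * (1 - β⁻¹) * (β⁻¹) ^ j := by positivity
    simp_rw [ENNReal.ofReal_mul h0]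
    rw [ENNReal.tsum_mul_left, ← ENNReal.ofReal_tsum_of_nonneg
      (fun k => (inv_pos.2 (hpos k)).le) hsummable]
    exact mul_le_of_le_one_right' (by simpa using hsum)
  refine (ENNReal.tsum_le_tsum hk).trans ?_
  rw [← ENNReal.ofReal_tsum_of_nonneg (fun j => by positivity)
    ((summable_geometric_of_lt_one hβ0.le hβ2).mul_left _), tsum_mul_left,
    tsum_geometric_of_lt_one hβ0.le hβ2, mul_assoc, mul_inv_cancel₀ hβ1.ne', mul_one]

/-- The explicit time-uniform bound. -/
theorem measure_exists_boundary_le {α β ρ ε : ℝ} (hα : 1 < α) (hβ : 1 < β) (hρ : 0 < ρ)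
    (hε : 0 < ε) (hε' : ε < 1) {h : ℝ → ℝ} (hmono : MonotoneOn h (Set.Ici 0))
    (hpos : ∀ k : ℕ, 0 < h k) (hsummable : Summable (fun k : ℕ => (h k)⁻¹))
    (hsum : ∑' k : ℕ, (h k)⁻¹ ≤ 1) {d : ℕ} (hd : 1 ≤ d) {δ : ℝ} (hδ : 0 < δ) (hδ' : δ < 1)
    {Ω : Type*} [MeasurableSpace Ω] {μ : Measure Ω} [IsProbabilityMeasure μ]
    {ℱ : Filtration ℕ (inferInstance : MeasurableSpace Ω)} {Λ : EReal} {ψ : ℝ → ℝ}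
    {S : ℕ → Ω → EuclideanSpace ℝ (Fin d)} {V : ℕ → Ω → Matrix (Fin d) (Fin d) ℝ}
    (hψ : IsCGFLike Λ ψ) (hu : HasUnboundedDeriv Λ ψ) (hs : IsSuperGaussian Λ ψ)
    (hS : IsVecSubPsi μ ℱ Λ ψ S V) :
    μ {ω | ∃ t : ℕ, √(gmin (clip (V t ω) ρ)) / (1 - ε) *
        conjInv Λ ψ (α / gmin (clip (V t ω) ρ) * Lcov α β ρ ε δ h (V t ω)) ≤
          ‖act (invSqrt (clip (V t ω) ρ)) (S t ω)‖} ≤ ENNReal.ofReal δ := by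
  have hβ0 : 0 < β := one_pos.trans hβ
  have hα0 : 0 < α := one_pos.trans hα
  have hh := one_le_of_tsum_inv_le hpos hsummable hsum
  have hnet : ∀ j : ℕ, ∃ T : Finset (EuclideanSpace ℝ (Fin d)), (∀ x ∈ T, ‖x‖ = 1) ∧
      (∀ x, ‖x‖ = 1 → ∃ y ∈ T, ‖y - x‖ ≤ ε / β ^ (j + 1)) ∧
      (T.card : ℝ) ≤ 2 * d * (3 / (ε / β ^ (j + 1))) ^ (d - 1) := fun j =>
    exists_sphere_net hd (by positivity)
      ((div_le_one (by positivity)).2 (hε'.le.trans (one_le_pow₀ hβ.le)))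
  choose T hT1 hT hTc using hnet
  have htan : ∀ j k, ∃ l ∈ dom Λ, (T j).Nonempty →
      conjInv Λ ψ (level β δ h (T j).card j k / (ρ * α ^ k)) * l
        = level β δ h (T j).card j k / (ρ * α ^ k) + ψ l := by
    intro j k
    by_cases hne : (T j).Nonempty
    · obtain ⟨-, ⟨l, hl, -, hl'⟩, -⟩ := hψ.conjInv_spec hu
        (c := level β δ h (T j).card j k / (ρ * α ^ k))
        (div_pos (level_pos hβ hδ hδ' hh hne.card_pos j k) (by positivity))
      exact ⟨l, hl, fun _ => hl'⟩
    -- An empty net contributes no event, so any point of the domain will do.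
    · exact ⟨0, zero_mem_dom hψ.pos, fun h => absurd h hne⟩
  choose l hl hlI using htan
  let bad (j k : ℕ) (ν : EuclideanSpace ℝ (Fin d)) : Set Ω :=
    {ω | ∃ t, level β δ h (T j).card j k
      ≤ l j k * inner ℝ ν (S t ω) - ψ (l j k) * inner ℝ ν (act (V t ω) ν)}
  have hbad : ∀ j k, ∀ ν ∈ T j, μ (bad j k ν)
      ≤ ENNReal.ofReal (δ * (1 - β⁻¹) * (β⁻¹) ^ j * (h k)⁻¹ / (T j).card) := by
    intro j k ν hν
    rw [← exp_neg_level hβ hδ hpos (Finset.card_pos.2 ⟨ν, hν⟩)]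
    exact (hS.proj ν (hT1 j ν hν)).measure_crossing_le (hl j k) _
  calc _ ≤ μ (⋃ j, ⋃ k, ⋃ ν ∈ T j, bad j k ν) := by
        refine measure_mono ?_
        rintro ω ⟨t, ht⟩
        obtain ⟨j, k, ν, hν, hc⟩ := exists_crossing hα hβ hρ hε hε' hδ hδ' hmono hh hd hψ hu hs
          hT1 hT hTc hl hlI (hS.posSemidef_V t ω).isHermitian ht
        simp only [mem_iUnion]
        exact ⟨j, k, ν, hν, t, hc⟩
    _ ≤ ∑' j : ℕ, ∑' k : ℕ, ENNReal.ofReal (δ * (1 - β⁻¹) * (β⁻¹) ^ j * (h k)⁻¹) := by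
        refine (measure_iUnion_le _).trans (ENNReal.tsum_le_tsum fun j => ?_)
        refine (measure_iUnion_le _).trans (ENNReal.tsum_le_tsum fun k => ?_)
        refine (measure_biUnion_finset_le _ _).trans ((Finset.sum_le_sum (hbad j k)).trans ?_)
        rw [Finset.sum_const, nsmul_eq_mul]
        rcases (T j).card.eq_zero_or_pos with h0 | h0
        · simp [h0]
        · rw [← ENNReal.ofReal_natCast, ← ENNReal.ofReal_mul (Nat.cast_nonneg _),
            mul_div_cancel₀ _ (by positivity)]
    _ ≤ _ := tsum_tsum_weight_le hβ hδ hpos hsummable hsum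

end Bound

/-! ### From the explicit boundary to the rate -/

section Rate

lemma exists_log_le_of_isBigO {α ρ : ℝ} (hα : 1 < α) (hρ : 0 < ρ) {h : ℝ → ℝ}
    (hmono : MonotoneOn h (Set.Ici 0)) (hh : ∀ k : ℕ, 1 ≤ h k)
    (hO : (fun k : ℕ => Real.log (h k)) =O[atTop] (fun k : ℕ => Real.log k)) :
    ∃ A B : ℝ, 0 ≤ B ∧ ∀ γ, ρ ≤ γ → Real.exp 1 ≤ γ →
      Real.log (h (Real.logb α (γ / ρ))) ≤ A + B * Real.log (Real.log γ) := by
  obtain ⟨c, hc, hO⟩ := hO.exists_nonneg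
  obtain ⟨k₀, hk₀⟩ := eventually_atTop.1 hO.bound
  have hlα : 0 < Real.log α := Real.log_pos hα
  set a := (1 + |Real.log ρ|) / Real.log α
  have ha : 0 ≤ a := by positivity
  refine ⟨c * Real.log (k₀ + 2 + a), c, hc, ?_⟩
  intro γ hγ hγe
  have hγ0 : 0 < γ := hρ.trans_le hγ
  have hlγ : 1 ≤ Real.log γ := (Real.le_log_iff_exp_le hγ0).2 hγe
  have hx0 : 0 ≤ Real.logb α (γ / ρ) := Real.logb_nonneg hα ((one_le_div hρ).2 hγ)
  have hxa : Real.logb α (γ / ρ) ≤ a * Real.log γ := by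
    rw [Real.logb, Real.log_div hγ0.ne' hρ.ne', div_mul_eq_mul_div]
    gcongr ?_ / _
    have := neg_abs_le (Real.log ρ)
    have := mul_le_mul_of_nonneg_left hlγ (abs_nonneg (Real.log ρ))
    linarith
  set x := Real.logb α (γ / ρ)
  -- Rounding up to an integer beyond `k₀` puts `k` where the asymptotic bound holds, and `k ≥ 1`
  -- keeps its logarithm non-negative.
  set k := k₀ + 1 + ⌈x⌉₊
  have hk1 : (1 : ℝ) ≤ k := by exact_mod_cast (by omega : 1 ≤ k)
  have hxk : x ≤ k := by
    refine (Nat.le_ceil x).trans ?_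
    exact_mod_cast (by omega : ⌈x⌉₊ ≤ k)
  have hkD : (k : ℝ) ≤ (k₀ + 2 + a) * Real.log γ := by
    have h1 := (Nat.ceil_lt_add_one hx0).le
    have h2 : (k : ℝ) = k₀ + 1 + ⌈x⌉₊ := by simp [k]
    have h3 : (k₀ + 2 : ℝ) ≤ (k₀ + 2) * Real.log γ := le_mul_of_one_le_right (by positivity) hlγ
    rw [h2]; linarith
  have hhx : 0 < h x := by
    have := hmono (mem_Ici.2 le_rfl) (mem_Ici.2 hx0) hx0
    have h0 := hh 0
    rw [Nat.cast_zero] at h0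
    linarith
  calc Real.log (h x) ≤ Real.log (h k) :=
        Real.log_le_log hhx (hmono (mem_Ici.2 hx0) (mem_Ici.2 (by linarith)) hxk)
    _ ≤ c * Real.log k := by
        have h1 := hk₀ k (by omega)
        rw [Real.norm_of_nonneg (Real.log_nonneg hk1)] at h1
        exact (Real.le_norm_self _).trans h1
    _ ≤ c * Real.log ((k₀ + 2 + a) * Real.log γ) := by gcongr
    _ = _ := by rw [Real.log_mul (by positivity) (by positivity)]; ring

/-- The part of the boundary that depends on neither the process nor `h`. -/
noncomputable def offset (β ε δ : ℝ) (d : ℕ) : ℝ :=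
  Real.log (coverConst d / (δ * (1 - β⁻¹))) + d * Real.log (3 * β / ε)

lemma Lcov_pos {α β ρ ε δ : ℝ} (hα : 1 < α) (hβ : 1 < β) (hρ : 0 < ρ) (hε : 0 < ε) (hε' : ε < 1)
    (hδ : 0 < δ) (hδ' : δ < 1) {h : ℝ → ℝ} (hmono : MonotoneOn h (Set.Ici 0))
    (hh : ∀ k : ℕ, 1 ≤ h k) {d : ℕ} (hd : 1 ≤ d) {V : Matrix (Fin d) (Fin d) ℝ}
    (hV : V.IsHermitian) : 0 < Lcov α β ρ ε δ h V := by
  have hβ0 : 0 < β⁻¹ := inv_pos.2 (one_pos.trans hβ)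
  have hβ1 : 0 < 1 - β⁻¹ := sub_pos.2 (inv_lt_one_of_one_lt₀ hβ)
  have hgρ := le_gmin_clip hd hV ρ
  have hg : 0 < gmin (clip V ρ) := hρ.trans_le hgρ
  have hgg := gmin_le_gmax hd (isHermitian_clip V ρ)
  have hx0 : 0 ≤ Real.logb α (gmax (clip V ρ) / ρ) :=
    Real.logb_nonneg hα ((one_le_div hρ).2 (hgρ.trans hgg))
  have hhx := hmono (mem_Ici.2 le_rfl) (mem_Ici.2 hx0) hx0
  have h0 := hh 0
  rw [Nat.cast_zero] at h0
  have hκ : 1 ≤ √(cond (clip V ρ)) := Real.one_le_sqrt.2 ((one_le_div hg).2 hgg)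
  have hC := two_mul_le_coverConst d
  have hd1 : (1 : ℝ) ≤ d := by exact_mod_cast hd
  refine add_pos_of_pos_of_nonneg (add_pos_of_nonneg_of_pos (Real.log_nonneg (h0.trans hhx))
    (Real.log_pos ?_)) (mul_nonneg (Nat.cast_nonneg d) (Real.log_nonneg ?_))
  · rw [one_lt_div (by positivity)]
    nlinarith
  · rw [one_le_div hε]
    nlinarith

/-- `M` absorbs all terms free of the process, `B` comes from `h`, and the final `1` pays for `d log
κ`. -/
lemma Lcov_le {α β ρ ε δ : ℝ} (hβ : 1 < β) (hρ : 0 < ρ) (hε : 0 < ε)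
    {h : ℝ → ℝ} {A B : ℝ} (hB : 0 ≤ B)
    (hAB : ∀ γ, ρ ≤ γ → Real.exp 1 ≤ γ →
      Real.log (h (Real.logb α (γ / ρ))) ≤ A + B * Real.log (Real.log γ))
    {d : ℕ} (hd : 1 ≤ d) {M Γ : ℝ} (hM : 0 ≤ M) (hΓ : Real.exp 1 < Γ)
    (hMΓ : A + offset β ε δ d ≤ M * Real.log (Real.log Γ))
    {V : Matrix (Fin d) (Fin d) ℝ} (hV : V.IsHermitian) (hVΓ : Γ ≤ gmax (clip V ρ)) :
    0 < rate (clip V ρ) ∧ Lcov α β ρ ε δ h V ≤ (M + B + 1) * rate (clip V ρ) := by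
  have hgρ := le_gmin_clip hd hV ρ
  have hgg := gmin_le_gmax hd (isHermitian_clip V ρ)
  set W := clip V ρ with hW
  have hg : 0 < gmin W := hρ.trans_le hgρ
  have hκ : 1 ≤ cond W := (one_le_div hg).2 hgg
  have hlκ : 0 ≤ Real.log (cond W) := Real.log_nonneg hκ
  have h1 := hAB (gmax W) (hgρ.trans hgg) (hΓ.le.trans hVΓ)
  have hΓ0 : 0 < Γ := (Real.exp_pos 1).trans hΓ
  have hlΓ : 1 < Real.log Γ := (Real.lt_log_iff_exp_lt hΓ0).2 hΓ
  have hLL : Real.log (Real.log Γ) ≤ Real.log (Real.log (gmax W)) :=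
    Real.log_le_log (by linarith) (Real.log_le_log hΓ0 hVΓ)
  have hLL0 : 0 < Real.log (Real.log Γ) := Real.log_pos hlΓ
  have h2 : Real.log (3 * β * √(cond W) / ε) ≤ Real.log (3 * β / ε) + Real.log (cond W) := by
    rw [mul_div_right_comm, Real.log_mul (by positivity) (by positivity),
      Real.log_sqrt (by linarith)]
    linarith
  have h3 := mul_le_mul_of_nonneg_left h2 (Nat.cast_nonneg (α := ℝ) d)
  have h4 := mul_le_mul_of_nonneg_left hLL hM
  have h5 : 0 ≤ d * Real.log (cond W) := mul_nonneg (Nat.cast_nonneg d) hlκ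
  refine ⟨by rw [rate]; linarith, ?_⟩
  have h6 := mul_nonneg (add_nonneg hM hB) h5
  rw [Lcov, rate, ← hW]
  rw [offset] at hMΓ
  linarith

/-- The explicit boundary is dominated by a multiple of the rate. -/
theorem measure_exists_rate_le {α β ρ ε : ℝ} (hα : 1 < α) (hβ : 1 < β) (hρ : 0 < ρ)
    (hε : 0 < ε) (hε' : ε < 1) {h : ℝ → ℝ} (hmono : MonotoneOn h (Set.Ici 0))
    (hpos : ∀ k : ℕ, 0 < h k) (hsummable : Summable (fun k : ℕ => (h k)⁻¹))
    (hsum : ∑' k : ℕ, (h k)⁻¹ ≤ 1) {A B : ℝ} (hB : 0 ≤ B)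
    (hAB : ∀ γ, ρ ≤ γ → Real.exp 1 ≤ γ →
      Real.log (h (Real.logb α (γ / ρ))) ≤ A + B * Real.log (Real.log γ))
    {d : ℕ} (hd : 1 ≤ d) {δ : ℝ} (hδ : 0 < δ) (hδ' : δ < 1)
    {M Γ : ℝ} (hM : 0 ≤ M) (hΓ : Real.exp 1 < Γ)
    (hMΓ : A + offset β ε δ d ≤ M * Real.log (Real.log Γ))
    {Ω : Type*} [MeasurableSpace Ω] {μ : Measure Ω} [IsProbabilityMeasure μ]
    {ℱ : Filtration ℕ (inferInstance : MeasurableSpace Ω)} {Λ : EReal} {ψ : ℝ → ℝ}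
    {S : ℕ → Ω → EuclideanSpace ℝ (Fin d)} {V : ℕ → Ω → Matrix (Fin d) (Fin d) ℝ}
    (hψ : IsCGFLike Λ ψ) (hu : HasUnboundedDeriv Λ ψ) (hs : IsSuperGaussian Λ ψ)
    (hS : IsVecSubPsi μ ℱ Λ ψ S V) :
    μ {ω | ∃ t : ℕ, Γ ≤ gmax (clip (V t ω) ρ) ∧
        α * (M + B + 1) / (1 - ε) * scale Λ ψ (clip (V t ω) ρ) (rate (clip (V t ω) ρ)) ≤
          ‖act (invSqrt (clip (V t ω) ρ)) (S t ω)‖} ≤ ENNReal.ofReal δ := by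
  refine le_trans (measure_mono ?_) (measure_exists_boundary_le hα hβ hρ hε hε' hmono hpos
    hsummable hsum hd hδ hδ' hψ hu hs hS)
  rintro ω ⟨t, hΓt, ht⟩
  refine ⟨t, le_trans ?_ ht⟩
  have hV : (V t ω).IsHermitian := (hS.posSemidef_V t ω).isHermitian
  have hg : 0 < gmin (clip (V t ω) ρ) := hρ.trans_le (le_gmin_clip hd hV ρ)
  have hL := Lcov_pos hα hβ hρ hε hε' hδ hδ' hmono (one_le_of_tsum_inv_le hpos hsummable hsum)
    hd hV
  obtain ⟨hr, hLr⟩ := Lcov_le hβ hρ hε hB hAB hd hM hΓ hMΓ hV hΓt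
  have hα0 : 0 < α := one_pos.trans hα
  have hε1 : 0 < 1 - ε := sub_pos.2 hε'
  set g := gmin (clip (V t ω) ρ)
  set r := rate (clip (V t ω) ρ)
  have h1 : conjInv Λ ψ (α / g * Lcov α β ρ ε δ h (V t ω))
      ≤ α * (M + B + 1) * conjInv Λ ψ (r / g) := by
    -- The constant leaves the inverse conjugate because `(ψ*)⁻¹(A c) ≤ A (ψ*)⁻¹(c)` for `A ≥ 1`.
    refine (hψ.conjInv_mono hu (by positivity) ?_).trans
      (hψ.conjInv_mul_le hu (by positivity) (by nlinarith))
    rw [div_mul_eq_mul_div, mul_div_assoc', mul_assoc]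
    gcongr
  calc _ ≤ √g / (1 - ε) * (α * (M + B + 1) * conjInv Λ ψ (r / g)) := by gcongr
    _ = _ := by rw [scale]; ring

end Rate

end SelfNorm

theorem corollary4p1 (α β ρ ε : ℝ) (hα : 1 < α) (hβ : 1 < β) (hρ : 0 < ρ)
    (hε : 0 < ε) (hε' : ε < 1)
    (h : ℝ → ℝ) (hmono : MonotoneOn h (Set.Ici 0)) (hpos : ∀ k : ℕ, 0 < h k)
    (hsummable : Summable (fun k : ℕ => (h k)⁻¹)) (hsum : ∑' k : ℕ, (h k)⁻¹ ≤ 1) :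
    -- the explicit time-uniform bound
    (∀ (d : ℕ), 1 ≤ d → ∀ (δ : ℝ), 0 < δ → δ < 1 →
      ∀ (Ω : Type*) [MeasurableSpace Ω] (μ : Measure Ω) [IsProbabilityMeasure μ]
        (ℱ : Filtration ℕ (inferInstance : MeasurableSpace Ω)) (Λ : EReal) (ψ : ℝ → ℝ)
        (S : ℕ → Ω → EuclideanSpace ℝ (Fin d)) (V : ℕ → Ω → Matrix (Fin d) (Fin d) ℝ),
        SelfNorm.IsCGFLike Λ ψ → SelfNorm.HasUnboundedDeriv Λ ψ →
        SelfNorm.IsSuperGaussian Λ ψ → SelfNorm.IsVecSubPsi μ ℱ Λ ψ S V →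
        μ {ω | ∃ t : ℕ,
            Real.sqrt (SelfNorm.gmin (SelfNorm.clip (V t ω) ρ)) / (1 - ε) *
                SelfNorm.conjInv Λ ψ
                  (α / SelfNorm.gmin (SelfNorm.clip (V t ω) ρ) *
                    SelfNorm.Lcov α β ρ ε δ h (V t ω)) ≤
              ‖SelfNorm.act (SelfNorm.invSqrt (SelfNorm.clip (V t ω) ρ)) (S t ω)‖}
          ≤ ENNReal.ofReal δ)
    ∧
    -- the rate, for `log h(k) = O(log k)`
    ((fun k : ℕ => Real.log (h k)) =O[atTop] (fun k : ℕ => Real.log k) →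
      -- for all large `γ_max`, with an implied constant that is free of `d` and `δ`
      (∃ K : ℝ, 0 < K ∧ ∀ (d : ℕ), 1 ≤ d → ∀ (δ : ℝ), 0 < δ → δ < 1 →
        ∃ Γ : ℝ, Real.exp 1 < Γ ∧
        ∀ (Ω : Type*) [MeasurableSpace Ω] (μ : Measure Ω) [IsProbabilityMeasure μ]
          (ℱ : Filtration ℕ (inferInstance : MeasurableSpace Ω)) (Λ : EReal) (ψ : ℝ → ℝ)
          (S : ℕ → Ω → EuclideanSpace ℝ (Fin d)) (V : ℕ → Ω → Matrix (Fin d) (Fin d) ℝ),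
          SelfNorm.IsCGFLike Λ ψ → SelfNorm.HasUnboundedDeriv Λ ψ →
          SelfNorm.IsSuperGaussian Λ ψ → SelfNorm.IsVecSubPsi μ ℱ Λ ψ S V →
          μ {ω | ∃ t : ℕ, Γ ≤ SelfNorm.gmax (SelfNorm.clip (V t ω) ρ) ∧
              K * SelfNorm.scale Λ ψ (SelfNorm.clip (V t ω) ρ)
                  (SelfNorm.rate (SelfNorm.clip (V t ω) ρ)) ≤
                ‖SelfNorm.act (SelfNorm.invSqrt (SelfNorm.clip (V t ω) ρ)) (S t ω)‖}
            ≤ ENNReal.ofReal δ)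
      ∧
      -- down to any fixed threshold `Γ > e`, with an implied constant that may depend on `d`, `δ`
      (∀ (d : ℕ), 1 ≤ d → ∀ (δ : ℝ), 0 < δ → δ < 1 → ∀ Γ : ℝ, Real.exp 1 < Γ →
        ∃ K : ℝ, 0 < K ∧
        ∀ (Ω : Type*) [MeasurableSpace Ω] (μ : Measure Ω) [IsProbabilityMeasure μ]
          (ℱ : Filtration ℕ (inferInstance : MeasurableSpace Ω)) (Λ : EReal) (ψ : ℝ → ℝ)
          (S : ℕ → Ω → EuclideanSpace ℝ (Fin d)) (V : ℕ → Ω → Matrix (Fin d) (Fin d) ℝ),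
          SelfNorm.IsCGFLike Λ ψ → SelfNorm.HasUnboundedDeriv Λ ψ →
          SelfNorm.IsSuperGaussian Λ ψ → SelfNorm.IsVecSubPsi μ ℱ Λ ψ S V →
          μ {ω | ∃ t : ℕ, Γ ≤ SelfNorm.gmax (SelfNorm.clip (V t ω) ρ) ∧
              K * SelfNorm.scale Λ ψ (SelfNorm.clip (V t ω) ρ)
                  (SelfNorm.rate (SelfNorm.clip (V t ω) ρ)) ≤
                ‖SelfNorm.act (SelfNorm.invSqrt (SelfNorm.clip (V t ω) ρ)) (S t ω)‖}
            ≤ ENNReal.ofReal δ)) := by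
  refine ⟨?_, fun hO => ?_⟩
  · intro d hd δ hδ hδ' Ω _ μ _ ℱ Λ ψ S V hψ hu hs hS
    exact SelfNorm.measure_exists_boundary_le hα hβ hρ hε hε' hmono hpos hsummable hsum hd hδ hδ'
      hψ hu hs hS
  obtain ⟨A, B, hB, hAB⟩ := SelfNorm.exists_log_le_of_isBigO hα hρ hmono
    (SelfNorm.one_le_of_tsum_inv_le hpos hsummable hsum) hO
  have hα0 : 0 < α := one_pos.trans hα
  have hε1 : 0 < 1 - ε := sub_pos.2 hε'
  constructor
  · refine ⟨α * (1 + B + 1) / (1 - ε), by positivity, fun d hd δ hδ hδ' => ?_⟩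
    set Q := A + SelfNorm.offset β ε δ d with hQ
    -- Taking `M = 1` keeps `K` free of `d` and `δ`; then `log log Γ = |Q| + 1` dominates `Q`, and
    -- the `+ 1` keeps `Γ > e` even if `Q = 0`.
    have hΓ : Real.exp 1 < Real.exp (Real.exp (|Q| + 1)) :=
      Real.exp_lt_exp.2 (Real.one_lt_exp_iff.2 (by positivity))
    refine ⟨_, hΓ, fun Ω _ μ _ ℱ Λ ψ S V hψ hu hs hS => ?_⟩
    refine SelfNorm.measure_exists_rate_le hα hβ hρ hε hε' hmono hpos hsummable hsum hB hAB hd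
      hδ hδ' zero_le_one hΓ ?_ hψ hu hs hS
    rw [Real.log_exp, Real.log_exp, one_mul, ← hQ]
    linarith [le_abs_self Q]
  · intro d hd δ hδ hδ' Γ hΓ
    have hΓ0 : 0 < Γ := (Real.exp_pos 1).trans hΓ
    have hLL : 0 < Real.log (Real.log Γ) := Real.log_pos ((Real.lt_log_iff_exp_lt hΓ0).2 hΓ)
    set Q := A + SelfNorm.offset β ε δ d with hQ
    -- With `Γ` fixed, `M = |Q| / log log Γ` absorbs the constants instead, so `K` now depends on
    -- `d`, `δ` and `Γ`.
    refine ⟨α * (|Q| / Real.log (Real.log Γ) + B + 1) / (1 - ε), by positivity,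
      fun Ω _ μ _ ℱ Λ ψ S V hψ hu hs hS => ?_⟩
    refine SelfNorm.measure_exists_rate_le hα hβ hρ hε hε' hmono hpos hsummable hsum hB hAB hd
      hδ hδ' (by positivity) hΓ ?_ hψ hu hs hS
    rw [div_mul_cancel₀ _ hLL.ne', ← hQ]
    exact le_abs_self Q
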